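/- For a finite unweighted digraph $G=(V,E)$, a \emph{consistent tie-breaking} selects, for every ordered pair $(u,v)$ such that $v$ is reachable from $u$, one shortest directed path $\pi(u\to v)$ (with the fewest edges), in such a way that every subpath of a selected path, from $x$ to $y$ say, is the selected path $\pi(x\to y)$. The shortest-path tree rooted at $v$ is then $\tau_v=\bigcup_{w}E(\pi(v\to w))\subseteq E$, where $w$ ranges over the vertices reachable from $v$, and $\overrightarrow{\mathcal{SP}}(G)=\{\tau_v : v\in V\}$. A set $X\subseteq E$ is \emph{shattered} by $\overrightarrow{\mathcal{SP}}(G)$ if $\{X\cap\tau_v : v\in V\}=2^X$, and the VC-dimension of $(E,\overrightarrow{\mathcal{SP}}(G))$ is the largest size of a shattered subset of $E$. \textbf{Theorem.} (i) For every integer $r\ge 1$ there exist a finite unweighted planar digraph $G=(V,E)$ and a set $X\subseteq E$ with $|X|=r$ such that $G$ has a consistent tie-breaking and, for every consistent tie-breaking of $G$, the set $X$ is shattered by $\overrightarrow{\mathcal{SP}}(G)$. (ii) Hence the edge set system of shortest-path trees has unbounded VC-dimension even in unweighted planar digraphs: for every integer $d\ge 0$ there is a finite unweighted planar digraph $G$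 that has a consistent tie-breaking and for which, under every consistent tie-breaking, $(E,\overrightarrow{\mathcal{SP}}(G))$ has VC-dimension greater than $d$. -/

import Mathlib

/-! ### Planarity -/

/-- `A` is a simple arc in the plane with end points `p` and `q`. -/
def IsPlaneArc (p q : ℝ × ℝ) (A : Set (ℝ × ℝ)) : Prop :=
  ∃ γ : unitInterval → ℝ × ℝ,
    Continuous γ ∧ Function.Injective γ ∧ γ 0 = p ∧ γ 1 = q ∧ Set.range γ = A

/-- A drawing of a simple graph in the plane without crossings: vertices are distinct points, each
edge is a simple arc joining its end points, an arc contains no other vertex, and two different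
arcs meet at most in a common end point. -/
structure PlaneDrawing {V : Type*} (H : SimpleGraph V) where
  point : V → ℝ × ℝ
  arc : Sym2 V → Set (ℝ × ℝ)
  point_injective : Function.Injective point
  isPlaneArc : ∀ u v : V, H.Adj u v → IsPlaneArc (point u) (point v) (arc s(u, v))
  mem_of_point_mem : ∀ e ∈ H.edgeSet, ∀ w : V, point w ∈ arc e → w ∈ e
  inter_arc : ∀ e ∈ H.edgeSet, ∀ f ∈ H.edgeSet, e ≠ f →
    ∀ p ∈ arc e ∩ arc f, ∃ w : V, w ∈ e ∧ w ∈ f ∧ p = point w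

namespace Digraph

/-- A digraph is planar if its underlying undirected graph can be drawn in the plane without
crossings. (Loops and antiparallel pairs of edges do not affect planarity.) -/
def IsPlanar {V : Type*} (G : Digraph V) : Prop :=
  Nonempty (PlaneDrawing G.toSimpleGraphInclusive)

/-! ### Directed walks and shortest paths -/

/-- `p` is the list of vertices of a directed walk from `u` to `v`. -/
def IsWalk {V : Type*} (G : Digraph V) (u v : V) (p : List V) : Prop :=
  p.IsChain G.Adj ∧ p.head? = some u ∧ p.getLast? = some v

/-- There is a directed walk from `u` to `v`. -/
def Reaches {V : Type*} (G : Digraph V) (u v : V) : Prop :=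
  ∃ p : List V, G.IsWalk u v p

/-- `p` is a directed walk from `u` to `v` with the least number of edges, that is, an (unweighted)
shortest path. The number of edges is one less than the number of vertices in the list. -/
def IsShortestPath {V : Type*} (G : Digraph V) (u v : V) (p : List V) : Prop :=
  G.IsWalk u v p ∧ ∀ q : List V, G.IsWalk u v q → p.length ≤ q.length

/-- The list of (directed) edges that a walk traverses. -/
def walkEdges {V : Type*} (p : List V) : List (V × V) := p.zip p.tail

/-- A consistent way of breaking ties between shortest paths: for every ordered pair `(u, v)` such
that `v` can be reached from `u`, one shortest path from `u` to `v` is selected, and every subpath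
of a selected path is itself the selected path between its end points. -/
structure TieBreaking {V : Type*} (G : Digraph V) where
  path : V → V → List V
  isShortestPath : ∀ u v : V, G.Reaches u v → G.IsShortestPath u v (path u v)
  consistent : ∀ u v : V, G.Reaches u v → ∀ (x y : V) (m : List V),
    m <:+: path u v → m.head? = some x → m.getLast? = some y → path x y = m

open Classical in
/-- The shortest path tree rooted at `v`, as a set of edges: the union of the selected shortest
paths from `v` to all vertices that can be reached from `v`. -/
noncomputable def TieBreaking.tree {V : Type*} [Fintype V] {G : Digraph V} (T : G.TieBreaking)
    (v : V) : Finset (V × V) :=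
  {e | ∃ w : V, G.Reaches v w ∧ e ∈ walkEdges (T.path v w)}

/-- The family of the shortest path trees of all vertices. -/
noncomputable def TieBreaking.shortestPathTrees {V : Type*} [Fintype V] [DecidableEq V]
    {G : Digraph V} (T : G.TieBreaking) : Finset (Finset (V × V)) :=
  Finset.univ.image T.tree

end Digraph

namespace Digraph

variable {V : Type*} {G : Digraph V}

theorem IsWalk.replace {u v x y : V} {a m m' b : List V} (h : G.IsWalk u v (a ++ m ++ b))
    (hm : G.IsWalk x y m) (hm' : G.IsWalk x y m') : G.IsWalk u v (a ++ m' ++ b) := by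
  obtain ⟨h1, h2, h3⟩ := h
  obtain ⟨-, m2, m3⟩ := hm
  obtain ⟨n1, n2, n3⟩ := hm'
  refine ⟨?_, ?_, ?_⟩
  · simp only [List.isChain_append, List.getLast?_append, m2, m3, n2, n3] at h1 ⊢
    exact ⟨⟨h1.1.1, n1, h1.1.2.2⟩, h1.2⟩
  · simpa [List.head?_append, m2, n2] using h2
  · simpa [List.getLast?_append, m3, n3] using h3

theorem IsWalk.of_infix {u v x y : V} {m p : List V} (h : G.IsWalk u v p) (hm : m <:+: p)
    (hx : m.head? = some x) (hy : m.getLast? = some y) : G.IsWalk x y m :=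
  ⟨h.1.infix hm, hx, hy⟩

/-- Selecting the shortlex-least walk is a consistent tie-breaking. -/
theorem nonempty_tieBreaking (G : Digraph V) : Nonempty G.TieBreaking := by
  classical
  have wf := List.Shortlex.wf (IsWellFounded.wf (r := (WellOrderingRel : V → V → Prop)))
  let R : List V → List V → Prop := List.Shortlex WellOrderingRel
  have exists_min (u v : V) : ∃ p : List V, G.Reaches u v →
      G.IsWalk u v p ∧ ∀ q, G.IsWalk u v q → ¬ R q p := by
    by_cases h : G.Reaches u v
    · obtain ⟨p, hp, hmin⟩ := wf.has_min {p | G.IsWalk u v p} h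
      exact ⟨p, fun _ => ⟨hp, hmin⟩⟩
    · exact ⟨[], fun h' => (h h').elim⟩
  choose path hpath using exists_min
  refine ⟨⟨path, fun u v h => ⟨(hpath u v h).1, fun q hq => ?_⟩, ?_⟩⟩
  · by_contra! hlt
    exact (hpath u v h).2 q hq (.of_length_lt hlt)
  · intro u v h x y m hm hx hy
    obtain ⟨hw, hmin⟩ := hpath u v h
    have hmw := hw.of_infix hm hx hy
    obtain ⟨hxy, hxmin⟩ := hpath x y ⟨m, hmw⟩
    obtain ⟨a, b, hab⟩ := hm
    have tri : Std.Trichotomous R := inferInstanceAs (Std.Trichotomous (List.Shortlex _))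
    refine tri.trichotomous _ _ (fun hlt => ?_) (hxmin m hmw)
    rw [← hab] at hw hmin
    refine hmin _ (hw.replace hmw hxy) ?_
    rcases List.shortlex_def.1 hlt with hl | ⟨hl, hlex⟩
    · exact .of_length_lt (by simpa using hl)
    · refine .of_lex (by simpa using hl) ?_
      rw [List.append_assoc, List.append_assoc]
      refine List.Lex.append_left _ ?_ _
      clear hw hmin hab hmw hxy hxmin hx hy
      generalize path x y = l at *
      clear hlt
      induction hlex with
      | nil => simp at hl
      | cons _ ih => exact .cons (ih (by simpa using hl))
      | rel h => exact .rel h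

theorem mem_walkEdges {p : List V} {a b : V} :
    (a, b) ∈ walkEdges p ↔ ∃ l₁ l₂, p = l₁ ++ a :: b :: l₂ := by
  induction p with
  | nil => simp [walkEdges]
  | cons c p ih =>
    cases p with
    | nil =>
      simp only [walkEdges, List.tail_cons, List.zip_nil_right, List.not_mem_nil, false_iff]
      rintro ⟨l₁, l₂, h⟩
      have := congrArg List.length h
      simp at this
      omega
    | cons d p =>
      have : walkEdges (c :: d :: p) = (c, d) :: walkEdges (d :: p) := by simp [walkEdges]
      rw [this, List.mem_cons, ih]
      constructor
      · rintro (h | ⟨l₁, l₂, h⟩)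
        · obtain ⟨rfl, rfl⟩ := Prod.mk.inj h
          exact ⟨[], p, rfl⟩
        · exact ⟨c :: l₁, l₂, by rw [h, List.cons_append]⟩
      · rintro ⟨_ | ⟨e, l₁⟩, l₂, h⟩
        · simp at h
          simp [h]
        · simp only [List.cons_append, List.cons.injEq] at h
          exact .inr ⟨l₁, l₂, h.2⟩

/-- `G.Steps n u v` says that there is a directed walk with `n` edges from `u` to `v`. -/
inductive Steps (G : Digraph V) (u : V) : ℕ → V → Prop
  | refl : Steps G u 0 u
  | tail {n : ℕ} {v w : V} : Steps G u n v → G.Adj v w → Steps G u (n + 1) w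

theorem Steps.exists_isWalk {n : ℕ} {u v : V} (h : G.Steps u n v) :
    ∃ p, G.IsWalk u v p ∧ p.length = n + 1 := by
  induction h with
  | refl => exact ⟨[u], ⟨by simp, rfl, rfl⟩, rfl⟩
  | @tail n v w _ hvw ih =>
    obtain ⟨p, ⟨h1, h2, h3⟩, h4⟩ := ih
    refine ⟨p ++ [w], ⟨?_, ?_, ?_⟩, by simp [h4]⟩
    · simp [List.isChain_append, h1, h3, hvw]
    · simp [List.head?_append, h2]
    · simp

theorem IsWalk.steps {u v : V} {p : List V} (h : G.IsWalk u v (p ++ [v])) :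
    G.Steps u p.length v := by
  induction p using List.reverseRecOn generalizing v with
  | nil =>
    obtain ⟨-, h2, -⟩ := h
    simp at h2
    subst h2
    exact .refl
  | append_singleton p w ih =>
    obtain ⟨h1, h2, -⟩ := h
    rw [List.isChain_append] at h1
    rw [List.length_append, List.length_singleton]
    refine .tail (ih ⟨h1.1, ?_, by simp⟩) (h1.2.2 w (by simp) v (by simp))
    rwa [List.head?_append_of_ne_nil _ (by simp)] at h2

theorem Steps.map {W : Type*} {H : Digraph W} (f : V → W)
    (hf : ∀ a b, G.Adj a b → H.Adj (f a) (f b)) {n : ℕ} {u v : V} (h : G.Steps u n v) :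
    H.Steps (f u) n (f v) := by
  induction h with
  | refl => exact .refl
  | tail _ hvw ih => exact ih.tail (hf _ _ hvw)

end Digraph

theorem isPlaneArc_segment {p q : ℝ × ℝ} (h : p ≠ q) : IsPlaneArc p q (segment ℝ p q) := by
  refine ⟨fun t => AffineMap.lineMap p q (t : ℝ), ?_, ?_, by simp, by simp, ?_⟩
  · exact AffineMap.lineMap_continuous.comp continuous_subtype_val
  · exact (AffineMap.lineMap_injective ℝ h).comp Subtype.val_injective
  · rw [segment_eq_image_lineMap]
    ext x
    simp [unitInterval]

/-- A lattice point, as a point of the real plane. -/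
def latticePoint (a : ℤ × ℤ) : ℝ × ℝ := (a.1, a.2)

theorem latticePoint_injective : Function.Injective latticePoint := by
  rintro ⟨a, b⟩ ⟨c, d⟩ h
  simpa [latticePoint] using h

/-- `b` is the right neighbour of `a`. -/
def IsFlat (a b : ℤ × ℤ) : Prop := b.2 = a.2 ∧ b.1 = a.1 + 1

/-- `b` lies in the row above that of `a`. -/
def IsRung (a b : ℤ × ℤ) : Prop := b.2 = a.2 + 1

theorem mem_segment_latticePoint {a b : ℤ × ℤ} {p : ℝ × ℝ} :
    p ∈ segment ℝ (latticePoint a) (latticePoint b) ↔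
      ∃ t : ℝ, 0 ≤ t ∧ t ≤ 1 ∧ p.1 = a.1 + t * (b.1 - a.1) ∧ p.2 = a.2 + t * (b.2 - a.2) := by
  rw [segment_eq_image']
  simp only [Set.mem_image, Set.mem_Icc, latticePoint, Prod.ext_iff, Prod.fst_add, Prod.snd_add,
    Prod.smul_fst, Prod.smul_snd, Prod.fst_sub, Prod.snd_sub, smul_eq_mul, and_assoc]
  simp only [eq_comm]

theorem eq_zero_or_one_of_int {t : ℝ} (h0 : 0 ≤ t) (h1 : t ≤ 1) {a b : ℤ} (h : (b : ℝ) = a + t) :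
    t = 0 ∨ t = 1 := by
  have ht : t = ((b - a : ℤ) : ℝ) := by push_cast; linarith
  rw [ht] at h0 h1 ⊢
  norm_cast at *
  omega

theorem eq_or_eq_of_latticePoint_mem_segment {a b c : ℤ × ℤ} (h : IsFlat a b ∨ IsRung a b)
    (hc : latticePoint c ∈ segment ℝ (latticePoint a) (latticePoint b)) : c = a ∨ c = b := by
  obtain ⟨t, h0, h1, hx, hy⟩ := mem_segment_latticePoint.1 hc
  have ht : t = 0 ∨ t = 1 := by
    simp only [latticePoint] at hx hy
    rcases h with ⟨-, h⟩ | h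
    · exact eq_zero_or_one_of_int h0 h1 (a := a.1) (b := c.1) (by rw [hx, h]; push_cast; ring)
    · exact eq_zero_or_one_of_int h0 h1 (a := a.2) (b := c.2) (by rw [hy, h]; push_cast; ring)
  rcases ht with rfl | rfl
  · exact .inl (latticePoint_injective (Prod.ext (by simpa [latticePoint] using hx)
      (by simpa [latticePoint] using hy)))
  · exact .inr (latticePoint_injective (Prod.ext (by simpa [latticePoint] using hx)
      (by simpa [latticePoint] using hy)))

/-- Two rungs between the same two rows that do not change sides meet only in lattice points. -/
theorem exists_latticePoint_of_rung {a b c d : ℤ × ℤ} {p : ℝ × ℝ} (hab : IsRung a b)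
    (hcd : IsRung c d) (hne : ¬ (a = c ∧ b = d))
    (hmono : a.2 = c.2 → a.1 ≤ c.1 ∧ b.1 ≤ d.1 ∨ c.1 ≤ a.1 ∧ d.1 ≤ b.1)
    (hp : p ∈ segment ℝ (latticePoint a) (latticePoint b))
    (hp' : p ∈ segment ℝ (latticePoint c) (latticePoint d)) :
    p = latticePoint a ∨ p = latticePoint b := by
  obtain ⟨t, h0, h1, hx, hy⟩ := mem_segment_latticePoint.1 hp
  obtain ⟨s, g0, g1, kx, ky⟩ := mem_segment_latticePoint.1 hp'
  unfold IsRung at hab hcd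
  have hy' : p.2 = a.2 + t := by rw [hy, hab]; push_cast; ring
  have ky' : p.2 = c.2 + s := by rw [ky, hcd]; push_cast; ring
  suffices ht : t = 0 ∨ t = 1 by
    rcases ht with rfl | rfl
    · exact .inl (Prod.ext (by simpa [latticePoint] using hx) (by simpa [latticePoint] using hy))
    · exact .inr (Prod.ext (by simpa [latticePoint] using hx) (by simpa [latticePoint] using hy))
  by_contra! ht
  have t0 : 0 < t := lt_of_le_of_ne h0 (Ne.symm ht.1)
  have t1 : t < 1 := lt_of_le_of_ne h1 ht.2
  have hac : a.2 = c.2 := by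
    have e1 : (a.2 : ℝ) < c.2 + 1 := by linarith
    have e2 : (c.2 : ℝ) < a.2 + 1 := by linarith
    norm_cast at e1 e2
    omega
  have hst : s = t := by rw [hac] at hy'; linarith
  subst hst
  have key : (1 - s) * ((c.1 : ℝ) - a.1) + s * ((d.1 : ℝ) - b.1) = 0 := by linarith
  have main : ∀ x y : ℝ, 0 ≤ x → 0 ≤ y → (1 - s) * x + s * y = 0 → x = 0 ∧ y = 0 := by
    intro x y hx hy h
    have e1 := mul_nonneg (sub_nonneg.2 h1) hx
    have e2 := mul_nonneg h0 hy
    constructor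
    · exact (mul_eq_zero.1 (by linarith : (1 - s) * x = 0)).resolve_left (by linarith)
    · exact (mul_eq_zero.1 (by linarith : s * y = 0)).resolve_left (by linarith)
  have h2 : b.2 = d.2 := by rw [hab, hcd, hac]
  have h3 : a.1 = c.1 ∧ b.1 = d.1 := by
    rcases hmono hac with ⟨m1, m2⟩ | ⟨m1, m2⟩
    · have n1 : (a.1 : ℝ) ≤ c.1 := by exact_mod_cast m1
      have n2 : (b.1 : ℝ) ≤ d.1 := by exact_mod_cast m2
      obtain ⟨e1, e2⟩ := main _ _ (sub_nonneg.2 n1) (sub_nonneg.2 n2) key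
      constructor
      · have : (a.1 : ℝ) = c.1 := by linarith
        exact_mod_cast this
      · have : (b.1 : ℝ) = d.1 := by linarith
        exact_mod_cast this
    · have n1 : (c.1 : ℝ) ≤ a.1 := by exact_mod_cast m1
      have n2 : (d.1 : ℝ) ≤ b.1 := by exact_mod_cast m2
      obtain ⟨e1, e2⟩ := main _ _ (sub_nonneg.2 n1) (sub_nonneg.2 n2) (by linarith)
      constructor
      · have : (a.1 : ℝ) = c.1 := by linarith
        exact_mod_cast this
      · have : (b.1 : ℝ) = d.1 := by linarith
        exact_mod_cast this
  exact hne ⟨Prod.ext h3.1 hac, Prod.ext h3.2 h2⟩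

/-- A flat edge meets a flat edge or a rung only in lattice points. -/
theorem exists_latticePoint_of_flat {a b c d : ℤ × ℤ} {p : ℝ × ℝ} (hab : IsFlat a b)
    (hcd : IsFlat c d ∨ IsRung c d) (hne : ¬ (a = c ∧ b = d))
    (hp : p ∈ segment ℝ (latticePoint a) (latticePoint b))
    (hp' : p ∈ segment ℝ (latticePoint c) (latticePoint d)) :
    p = latticePoint c ∨ p = latticePoint d := by
  obtain ⟨t, h0, h1, hx, hy⟩ := mem_segment_latticePoint.1 hp
  obtain ⟨s, g0, g1, kx, ky⟩ := mem_segment_latticePoint.1 hp'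
  obtain ⟨hab2, hab1⟩ := hab
  have hy' : p.2 = a.2 := by rw [hy, hab2]; ring
  have hx' : p.1 = a.1 + t := by rw [hx, hab1]; push_cast; ring
  suffices hs : s = 0 ∨ s = 1 by
    rcases hs with rfl | rfl
    · exact .inl (Prod.ext (by simpa [latticePoint] using kx) (by simpa [latticePoint] using ky))
    · exact .inr (Prod.ext (by simpa [latticePoint] using kx) (by simpa [latticePoint] using ky))
  rcases hcd with ⟨hcd2, hcd1⟩ | hcd
  · have ky' : p.2 = c.2 := by rw [ky, hcd2]; ring
    have kx' : p.1 = c.1 + s := by rw [kx, hcd1]; push_cast; ring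
    have e2 : a.2 = c.2 := by
      have : (a.2 : ℝ) = c.2 := by linarith
      exact_mod_cast this
    by_contra! hs
    have s0 : 0 < s := lt_of_le_of_ne g0 (Ne.symm hs.1)
    have s1 : s < 1 := lt_of_le_of_ne g1 hs.2
    have e1 : a.1 = c.1 := by
      have i1 : (a.1 : ℝ) < c.1 + 1 := by linarith
      have i2 : (c.1 : ℝ) < a.1 + 1 := by linarith
      norm_cast at i1 i2
      omega
    exact hne ⟨Prod.ext e1 e2, Prod.ext (by rw [hab1, hcd1, e1]) (by rw [hab2, hcd2, e2])⟩
  · refine eq_zero_or_one_of_int g0 g1 (a := c.2) (b := a.2) ?_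
    rw [← hy', ky, hcd]
    push_cast
    ring

/-- A graph whose vertices are lattice points is planar if its edges join horizontal neighbours or
points of consecutive rows, and edges between the same two rows do not cross. -/
theorem nonempty_planeDrawing_of_rungs {V : Type*} {H : SimpleGraph V} (f : V → ℤ × ℤ)
    (hf : Function.Injective f)
    (hadj : ∀ u v, H.Adj u v →
      (IsFlat (f u) (f v) ∨ IsRung (f u) (f v)) ∨ (IsFlat (f v) (f u) ∨ IsRung (f v) (f u)))
    (hmono : ∀ a b c d, H.Adj a b → H.Adj c d → IsRung (f a) (f b) → IsRung (f c) (f d) →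
      (f a).2 = (f c).2 →
        (f a).1 ≤ (f c).1 ∧ (f b).1 ≤ (f d).1 ∨ (f c).1 ≤ (f a).1 ∧ (f d).1 ≤ (f b).1) :
    Nonempty (PlaneDrawing H) := by
  let arc : Sym2 V → Set (ℝ × ℝ) := Sym2.lift
    ⟨fun u v => segment ℝ (latticePoint (f u)) (latticePoint (f v)), fun _ _ => segment_symm ..⟩
  have orient : ∀ e ∈ H.edgeSet, ∃ a b, e = s(a, b) ∧ H.Adj a b ∧
      (IsFlat (f a) (f b) ∨ IsRung (f a) (f b)) := by
    intro e
    induction e with | _ a b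
    intro he
    rcases hadj a b he with h | h
    · exact ⟨a, b, rfl, he, h⟩
    · exact ⟨b, a, Sym2.eq_swap, SimpleGraph.Adj.symm he, h⟩
  have hmem : ∀ e ∈ H.edgeSet, ∀ w : V, latticePoint (f w) ∈ arc e → w ∈ e := by
    intro e he w hw
    obtain ⟨a, b, rfl, -, h⟩ := orient e he
    rw [Sym2.mem_iff]
    exact (eq_or_eq_of_latticePoint_mem_segment h hw).imp (fun h => hf h) (fun h => hf h)
  refine ⟨⟨fun v => latticePoint (f v), arc, latticePoint_injective.comp hf, ?_, hmem, ?_⟩⟩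
  · intro u v h
    exact isPlaneArc_segment (fun h' => h.ne (hf (latticePoint_injective h')))
  · intro e he e' he' hne p ⟨hp, hp'⟩
    suffices ∃ w, p = latticePoint (f w) by
      obtain ⟨w, rfl⟩ := this
      exact ⟨w, hmem e he w hp, hmem e' he' w hp', rfl⟩
    obtain ⟨a, b, rfl, hab, h⟩ := orient e he
    obtain ⟨c, d, rfl, hcd, h'⟩ := orient e' he'
    have hne' : ¬ (f a = f c ∧ f b = f d) := fun ⟨h1, h2⟩ => hne (by rw [hf h1, hf h2])
    have hne'' : ¬ (f c = f a ∧ f d = f b) := fun ⟨h1, h2⟩ => hne (by rw [hf h1, hf h2])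
    rcases h with h | h
    · exact (exists_latticePoint_of_flat h h' hne' hp hp').elim (⟨_, ·⟩) (⟨_, ·⟩)
    rcases h' with h' | h'
    · exact (exists_latticePoint_of_flat h' (.inr h) hne'' hp' hp).elim (⟨_, ·⟩) (⟨_, ·⟩)
    · exact (exists_latticePoint_of_rung h h' hne' (hmono a b c d hab hcd h h') hp hp').elim
        (⟨_, ·⟩) (⟨_, ·⟩)

/-- The lattice points of a box that is symmetric about the horizontal axis. -/
abbrev Cell (L r : ℤ) : Type :=
  ↥(Finset.Icc (0 : ℤ) (L + r) ×ˢ Finset.Icc (-r) r : Finset (ℤ × ℤ))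

namespace Cell

variable {L r : ℤ}

theorem bounds (c : Cell L r) : 0 ≤ c.1.1 ∧ c.1.1 ≤ L + r ∧ -r ≤ c.1.2 ∧ c.1.2 ≤ r := by
  have := c.2
  simp only [Finset.mem_product, Finset.mem_Icc] at this
  tauto

/-- The lattice point `(x, y)` as a cell. -/
def mk (x y : ℤ) (h : 0 ≤ x ∧ x ≤ L + r ∧ -r ≤ y ∧ y ≤ r) : Cell L r :=
  ⟨(x, y), by simp only [Finset.mem_product, Finset.mem_Icc]; tauto⟩

/-- Reflection in the horizontal axis. -/
def flip (c : Cell L r) : Cell L r :=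
  mk c.1.1 (-c.1.2) (by have := c.bounds; omega)

theorem flip_flip (c : Cell L r) : c.flip.flip = c := by
  simp [flip, mk]

@[simp] theorem flip_fst (c : Cell L r) : c.flip.1.1 = c.1.1 := rfl

@[simp] theorem flip_snd (c : Cell L r) : c.flip.1.2 = -c.1.2 := rfl

theorem ext_iff' {a b : Cell L r} : a = b ↔ a.1.1 = b.1.1 ∧ a.1.2 = b.1.2 := by
  rw [Subtype.ext_iff, Prod.ext_iff]

end Cell

/-- The edges of the half of the fan digraph above the horizontal axis: row `j ≥ 1` runs to the
right until `x = L + j`; the `k`-th rib runs upwards through the points `(q k j, j)`; the columns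
`x = L + m` run downwards from row `m`. -/
def HalfAdj (N : ℕ) (L : ℤ) (q : ℕ → ℤ → ℤ) (a b : ℤ × ℤ) : Prop :=
  (1 ≤ a.2 ∧ b.2 = a.2 ∧ b.1 = a.1 + 1 ∧ b.1 ≤ L + a.2) ∨
  (0 ≤ a.2 ∧ b.2 = a.2 + 1 ∧ ∃ k < N, a.1 = q k a.2 ∧ b.1 = q k b.2) ∨
  (0 ≤ b.2 ∧ a.2 = b.2 + 1 ∧ b.1 = a.1 ∧ L + a.2 ≤ a.1)

/-- The ribs run in disjoint positions, and get closer to each other from row to row. -/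
structure IsFan (N : ℕ) (L r : ℤ) (q : ℕ → ℤ → ℤ) : Prop where
  nonneg : ∀ k < N, ∀ j, 0 ≤ j → j ≤ r → 0 ≤ q k j
  le : ∀ k < N, ∀ j, 0 ≤ j → j ≤ r → q k j ≤ L
  lt : ∀ k l, k < l → l < N → ∀ j, 0 ≤ j → j ≤ r → q k j < q l j
  gap : ∀ k l, k < l → l < N → ∀ j, 0 ≤ j → j + 1 ≤ r →
    q l (j + 1) - q k (j + 1) ≤ q l j - q k j

/-- The digraph consisting of the half fan of `q` above the horizontal axis and of the mirror image
of the half fan of `q'` below it. -/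
def fan (N : ℕ) (L r : ℤ) (q q' : ℕ → ℤ → ℤ) : Digraph (Cell L r) where
  Adj a b := HalfAdj N L q a.1 b.1 ∨ HalfAdj N L q' a.flip.1 b.flip.1

section Fan

variable {N : ℕ} {L r : ℤ} {q q' : ℕ → ℤ → ℤ}

theorem IsFan.le_of_le (hq : IsFan N L r q) {k l : ℕ} (hk : k < N) {j : ℤ}
    (h0 : 0 ≤ j) (hr : j ≤ r) (h : q k j ≤ q l j) : k ≤ l := by
  by_contra! hlt
  exact absurd (hq.lt l k hlt hk j h0 hr) (by omega)

theorem IsFan.gap_le (hq : IsFan N L r q) {k l : ℕ} (h : k ≤ l) (hl : l < N) {j : ℤ}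
    (h0 : 0 ≤ j) (hr : j + 1 ≤ r) : q l (j + 1) - q k (j + 1) ≤ q l j - q k j := by
  rcases h.eq_or_lt with rfl | h
  · omega
  · exact hq.gap k l h hl j h0 hr

theorem fan_adj_flip {a b : Cell L r} (h : (fan N L r q q').Adj a b) :
    (fan N L r q' q).Adj a.flip b.flip := by
  simpa only [fan, Cell.flip_flip] using Or.symm h

/-- The rungs of a half fan, with the lower end point first. -/
theorem IsFan.rung_mono (hq : IsFan N L r q) {a b c d : ℤ × ℤ}
    (hab : HalfAdj N L q a b ∨ HalfAdj N L q b a) (hcd : HalfAdj N L q c d ∨ HalfAdj N L q d c)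
    (h1 : b.2 = a.2 + 1) (h2 : d.2 = c.2 + 1) (h3 : a.2 = c.2) (hr : b.2 ≤ r) :
    a.1 ≤ c.1 ∧ b.1 ≤ d.1 ∨ c.1 ≤ a.1 ∧ d.1 ≤ b.1 := by
  have key : ∀ {a b : ℤ × ℤ}, HalfAdj N L q a b ∨ HalfAdj N L q b a → b.2 = a.2 + 1 →
      0 ≤ a.2 ∧ ((∃ k < N, a.1 = q k a.2 ∧ b.1 = q k b.2) ∨ L < a.1 ∧ b.1 = a.1) := by
    intro a b h h'
    rcases h with (h | h | h) | (h | h | h)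
    · omega
    · exact ⟨h.1, .inl h.2.2⟩
    · omega
    · omega
    · omega
    · exact ⟨h.1, .inr (by omega)⟩
  obtain ⟨h0, hab⟩ := key hab h1
  obtain ⟨-, hcd⟩ := key hcd h2
  rw [← h3] at hcd
  have hd : d.2 = b.2 := by omega
  rw [hd] at hcd
  rcases hab with ⟨k, hk, ka, kb⟩ | ⟨ha, hb⟩ <;> rcases hcd with ⟨l, hl, lc, ld⟩ | ⟨hc, hd⟩
  · rcases lt_trichotomy k l with h | rfl | h
    · have := hq.lt k l h hl a.2 h0 (by omega)
      have := hq.lt k l h hl b.2 (by omega) hr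
      omega
    · omega
    · have := hq.lt l k h hk a.2 h0 (by omega)
      have := hq.lt l k h hk b.2 (by omega) hr
      omega
  · have := hq.le k hk a.2 h0 (by omega)
    have := hq.le k hk b.2 (by omega) hr
    omega
  · have := hq.le l hl a.2 h0 (by omega)
    have := hq.le l hl b.2 (by omega) hr
    omega
  · omega

theorem fan_isPlanar (hq : IsFan N L r q) (hq' : IsFan N L r q') :
    (fan N L r q q').IsPlanar := by
  have key : ∀ {a b : Cell L r}, (fan N L r q q').toSimpleGraphInclusive.Adj a b →
      (HalfAdj N L q a.1 b.1 ∨ HalfAdj N L q b.1 a.1) ∨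
      (HalfAdj N L q' a.flip.1 b.flip.1 ∨ HalfAdj N L q' b.flip.1 a.flip.1) := by
    rintro a b ⟨-, (h | h) | (h | h)⟩ <;> tauto
  refine nonempty_planeDrawing_of_rungs (fun c => c.1) Subtype.val_injective ?_ ?_
  · intro a b h
    have h := key h
    simp only [HalfAdj, Cell.flip_fst, Cell.flip_snd] at h
    simp only [IsFlat, IsRung]
    omega
  · intro a b c d hab hcd h1 h2 h3
    simp only [IsRung] at h1 h2
    have hb := b.bounds
    have ha := a.bounds
    have up : ∀ {a b : Cell L r}, b.1.2 = a.1.2 + 1 →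
        (HalfAdj N L q a.1 b.1 ∨ HalfAdj N L q b.1 a.1) → 0 ≤ a.1.2 := by
      intro a b h1 h
      simp only [HalfAdj] at h
      omega
    have down : ∀ {a b : Cell L r}, b.1.2 = a.1.2 + 1 →
        (HalfAdj N L q' a.flip.1 b.flip.1 ∨ HalfAdj N L q' b.flip.1 a.flip.1) → b.1.2 ≤ 0 := by
      intro a b h1 h
      simp only [HalfAdj, Cell.flip_fst, Cell.flip_snd] at h
      omega
    rcases key hab with hab | hab <;> rcases key hcd with hcd | hcd
    · exact hq.rung_mono hab hcd h1 h2 h3 hb.2.2.2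
    · have := up h1 hab
      have := down h2 hcd
      omega
    · have := down h1 hab
      have := up h2 hcd
      omega
    · have := hq'.rung_mono hab.symm hcd.symm (by simp only [Cell.flip_snd]; omega)
        (by simp only [Cell.flip_snd]; omega) (by simp only [Cell.flip_snd]; omega)
        (by simp only [Cell.flip_snd]; omega)
      simp only [Cell.flip_fst] at this
      omega

/-- Going up a rib, along row `m` and down the column `x = L + m`. -/
theorem fan_steps (hq : IsFan N L r q) {k : ℕ} (hk : k < N) {s b : Cell L r}
    (hs1 : s.1.1 = q k 0) (hs2 : s.1.2 = 0) {m : ℕ} (hm : 1 ≤ m) (hmr : (m : ℤ) ≤ r)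
    (hb1 : b.1.1 = L + m) (hb2 : b.1.2 = 0) :
    (fan N L r q q').Steps s (m + (L + m - q k m).toNat + m) b := by
  have up : ∀ j : ℕ, (j : ℤ) ≤ r → ∀ c : Cell L r, c.1.1 = q k j → c.1.2 = j →
      (fan N L r q q').Steps s j c := by
    intro j
    induction j with
    | zero =>
      intro _ c h1 h2
      have : c = s := Cell.ext_iff'.2 ⟨by rw [h1, hs1]; rfl, by rw [h2, hs2]; rfl⟩
      rw [this]
      exact .refl
    | succ j ih =>
      intro hj c h1 h2
      push_cast at hj h1 h2
      have := hq.nonneg k hk j (by omega) (by omega)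
      have := hq.le k hk j (by omega) (by omega)
      refine .tail (ih (by omega) (.mk (q k j) j (by omega)) rfl rfl) (.inl (.inr (.inl ?_)))
      exact ⟨by simp [Cell.mk], by simp [Cell.mk, h2], k, hk, rfl, by rw [h1, h2]⟩
  have hn := hq.nonneg k hk m (by omega) hmr
  have hl := hq.le k hk m (by omega) hmr
  have right : ∀ t : ℕ, q k m + t ≤ L + m → ∀ c : Cell L r, c.1.1 = q k m + t → c.1.2 = m →
      (fan N L r q q').Steps s (m + t) c := by
    intro t
    induction t with
    | zero =>
      intro _ c h1 h2
      exact up m hmr c (by simpa using h1) h2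
    | succ t ih =>
      intro ht c h1 h2
      push_cast at ht h1
      refine .tail (ih (by omega) (.mk (q k m + t) m (by omega)) rfl rfl) (.inl (.inl ?_))
      simp only [Cell.mk]
      omega
  have down : ∀ t : ℕ, t ≤ m → ∀ c : Cell L r, c.1.1 = L + m → c.1.2 = m - t →
      (fan N L r q q').Steps s (m + (L + m - q k m).toNat + t) c := by
    intro t
    induction t with
    | zero =>
      intro _ c h1 h2
      exact right _ (by omega) c (by omega) (by simpa using h2)
    | succ t ih =>
      intro ht c h1 h2
      push_cast at h2
      refine .tail (ih (by omega) (.mk (L + m) (m - t) (by omega)) rfl rfl)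
        (.inl (.inr (.inr ?_)))
      simp only [Cell.mk]
      omega
  exact down m le_rfl b hb1 (by omega)

/-- Lower bounds for the number `n` of edges of a walk to `c` from the foot of the `k`-th rib. -/
def LowerBound (L : ℤ) (q : ℕ → ℤ → ℤ) (k n : ℕ) (c : ℤ × ℤ) : Prop :=
  (c.2 = 0 → c.1 = q k 0 ∨ L < c.1) ∧
  (0 < c.2 → q k c.2 ≤ c.1 ∧ (c.1 ≤ L + c.2 → c.2 + c.1 - q k c.2 ≤ n) ∧
    ∀ m, c.2 ≤ m → c.1 = L + m → 3 * m + L - q k m - c.2 ≤ n)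

theorem IsFan.lowerBound (hq : IsFan N L r q) {k : ℕ} (hk : k < N)
    {s : Cell L r} (hs1 : s.1.1 = q k 0) (hs2 : s.1.2 = 0) {n : ℕ} {c : Cell L r}
    (h : (fan N L r q q').Steps s n c) : LowerBound L q k n c.1 := by
  induction h with
  | refl => exact ⟨fun _ => .inl hs1, fun h => absurd h (by omega)⟩
  | @tail n a b _ hab ih =>
    obtain ⟨⟨ax, ay⟩, ha⟩ := a
    obtain ⟨⟨x, y⟩, hb⟩ := b
    have hA := Cell.bounds ⟨(ax, ay), ha⟩
    have hB := Cell.bounds ⟨(x, y), hb⟩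
    unfold LowerBound at ih ⊢
    simp only [fan, HalfAdj, Cell.flip_fst, Cell.flip_snd] at hab ih hA hB ⊢
    obtain ⟨ih0, ih1⟩ := ih
    rcases hab with (⟨h1, h2, h3, h4⟩ | ⟨h1, h2, l, hl, h3, h4⟩ | ⟨h1, h2, h3, h4⟩) | hab
    · subst h2 h3
      refine ⟨fun h => absurd h (by omega), fun _ => ?_⟩
      obtain ⟨i1, i2, i3⟩ := ih1 (by omega)
      refine ⟨by omega, fun _ => by push_cast; omega, fun m hm hx => ?_⟩
      obtain rfl : m = y := by omega
      push_cast
      omega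
    · subst h2
      have hlL := hq.le l hl (ay + 1) (by omega) (by omega)
      have hlL' := hq.le l hl ay (by omega) (by omega)
      have hkl : k ≤ l := by
        refine hq.le_of_le hk h1 (by omega) ?_
        rcases h1.eq_or_lt with rfl | h1
        · have := ih0 rfl
          omega
        · have := (ih1 h1).1
          omega
      have gap := hq.gap_le hkl hl h1 (by omega)
      have mono : q k (ay + 1) ≤ q l (ay + 1) := by
        rcases hkl.eq_or_lt with rfl | h
        · exact le_rfl
        · exact (hq.lt k l h hl _ (by omega) (by omega)).le
      refine ⟨fun h => absurd h (by omega), fun _ => ⟨by omega, fun _ => ?_, fun m hm hx => ?_⟩⟩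
      · push_cast
        rcases h1.eq_or_lt with rfl | h1
        · have := ih0 rfl
          have : ax = q k 0 := by omega
          omega
        · have := (ih1 h1).2.1 (by omega)
          omega
      · omega
    · subst h2 h3
      refine ⟨fun _ => .inr (by omega), fun hy => ?_⟩
      have := hq.le k hk y h1 (by omega)
      refine ⟨by omega, fun _ => by omega, fun m hm hx => ?_⟩
      have := (ih1 (by omega)).2.2 m (by omega) hx
      push_cast
      omega
    · refine ⟨fun _ => .inr (by omega), fun hy => absurd hab (by omega)⟩

theorem IsFan.le_of_steps (hq : IsFan N L r q) {k : ℕ} (hk : k < N)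
    {s c : Cell L r} (hs1 : s.1.1 = q k 0) (hs2 : s.1.2 = 0) {m : ℕ} (hm : 1 ≤ m)
    (hc1 : c.1.1 = L + m) (hc2 : c.1.2 = 1) {n : ℕ} (h : (fan N L r q q').Steps s n c) :
    3 * m + L - q k m - 1 ≤ n := by
  have := ((hq.lowerBound hk hs1 hs2 h).2 (by omega)).2.2 m (by omega) hc1
  omega

theorem fan_adj_sink {m : ℕ} {a b : Cell L r} (hb1 : b.1.1 = L + m)
    (hb2 : b.1.2 = 0) (h : (fan N L r q q').Adj a b) :
    a.1.1 = L + m ∧ (a.1.2 = 1 ∨ a.1.2 = -1) := by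
  simp only [fan, HalfAdj, Cell.flip_fst, Cell.flip_snd] at h
  omega

/-- The last edge of a shortest walk to a sink comes from above if the rib of the upper half is
ahead. -/
theorem IsFan.snd_eq_one (hq : IsFan N L r q) (hq' : IsFan N L r q')
    {k : ℕ} (hk : k < N) (h0 : q k 0 = q' k 0) {s a b : Cell L r} (hs1 : s.1.1 = q k 0)
    (hs2 : s.1.2 = 0) {m : ℕ} (hm : 1 ≤ m) (hmr : (m : ℤ) ≤ r) (hb1 : b.1.1 = L + m)
    (hb2 : b.1.2 = 0) (hlt : q' k m < q k m) {n : ℕ} (ha : (fan N L r q q').Steps s n a)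
    (hab : (fan N L r q q').Adj a b) (hmin : ∀ n', (fan N L r q q').Steps s n' b → n < n') :
    a.1.1 = L + m ∧ a.1.2 = 1 := by
  obtain ⟨h1, h2⟩ := fan_adj_sink hb1 hb2 hab
  refine ⟨h1, h2.resolve_right fun h2 => ?_⟩
  have hflip := ha.map (H := fan N L r q' q) Cell.flip (fun _ _ => fan_adj_flip)
  have lower := hq'.le_of_steps hk (s := s.flip) (c := a.flip) (by simp [hs1, h0]) (by simp [hs2])
    hm (by simp [h1]) (by simp [h2]) hflip
  have := hmin _ (fan_steps hq hk hs1 hs2 hm hmr hb1 hb2)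
  have := hq.le k hk m (by omega) hmr
  omega

theorem IsFan.snd_eq_neg_one (hq : IsFan N L r q) (hq' : IsFan N L r q')
    {k : ℕ} (hk : k < N) (h0 : q k 0 = q' k 0) {s a b : Cell L r} (hs1 : s.1.1 = q k 0)
    (hs2 : s.1.2 = 0) {m : ℕ} (hm : 1 ≤ m) (hmr : (m : ℤ) ≤ r) (hb1 : b.1.1 = L + m)
    (hb2 : b.1.2 = 0) (hlt : q k m < q' k m) {n : ℕ} (ha : (fan N L r q q').Steps s n a)
    (hab : (fan N L r q q').Adj a b) (hmin : ∀ n', (fan N L r q q').Steps s n' b → n < n') :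
    a.1.2 = -1 := by
  have := (hq'.snd_eq_one hq hk h0.symm (s := s.flip) (a := a.flip) (b := b.flip)
    (by simp [hs1, h0]) (by simp [hs2]) hm hmr (by simp [hb1]) (by simp [hb2]) hlt
    (ha.map Cell.flip (fun _ _ => fan_adj_flip)) (fan_adj_flip hab) (fun n' h => hmin n' (by
      simpa only [Cell.flip_flip] using
        h.map (H := fan N L r q q') Cell.flip (fun _ _ => fan_adj_flip)))).2
  simp only [Cell.flip_snd] at this
  omega

end Fan

theorem Digraph.IsShortestPath.steps {V : Type*} {G : Digraph V} {u a b : V} {l : List V}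
    (h : G.IsShortestPath u b (l ++ [a, b])) :
    G.Steps u l.length a ∧ G.Adj a b ∧ ∀ n, G.Steps u n b → l.length < n := by
  obtain ⟨hw, hmin⟩ := h
  refine ⟨?_, ?_, fun n hn => ?_⟩
  · refine (hw.of_infix (m := l ++ [a]) ⟨[], [b], by simp⟩ ?_ (by simp)).steps
    simpa [List.head?_append] using hw.2.1
  · simpa using (List.isChain_append.1 hw.1).2.1
  · obtain ⟨p, hp, hlen⟩ := hn.exists_isWalk
    have := hmin p hp
    simp only [List.length_append, List.length_cons, List.length_nil] at this
    omega

theorem Digraph.IsWalk.exists_append_pair {V : Type*} {G : Digraph V} {u b : V} {p : List V}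
    (h : G.IsWalk u b p) (hne : u ≠ b) : ∃ l a, p = l ++ [a, b] := by
  obtain ⟨-, h2, h3⟩ := h
  obtain ⟨p, rfl⟩ := List.getLast?_eq_some_iff.1 h3
  rcases List.eq_nil_or_concat p with rfl | ⟨l, a, rfl⟩
  · simp at h2
    exact absurd h2.symm hne
  · exact ⟨l, a, by simp⟩

section Fan

open Digraph

variable {N : ℕ} {L r : ℤ} {q q' : ℕ → ℤ → ℤ}

theorem IsFan.mem_tree (hq : IsFan N L r q) (hq' : IsFan N L r q')
    {k : ℕ} (hk : k < N) (h0 : q k 0 = q' k 0) {s a b : Cell L r} (hs1 : s.1.1 = q k 0)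
    (hs2 : s.1.2 = 0) {m : ℕ} (hm : 1 ≤ m) (hmr : (m : ℤ) ≤ r) (ha1 : a.1.1 = L + m)
    (ha2 : a.1.2 = 1) (hb1 : b.1.1 = L + m) (hb2 : b.1.2 = 0) (hlt : q' k m < q k m)
    (T : (fan N L r q q').TieBreaking) : (a, b) ∈ T.tree s := by
  have hreach : (fan N L r q q').Reaches s b := by
    obtain ⟨p, hp, -⟩ := (fan_steps (q' := q') hq hk hs1 hs2 hm hmr hb1 hb2).exists_isWalk
    exact ⟨p, hp⟩
  have hp := T.isShortestPath s b hreach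
  have hne : s ≠ b := by
    rintro rfl
    have := hq.le k hk 0 le_rfl (by omega)
    omega
  obtain ⟨l, c, hc⟩ := hp.1.exists_append_pair hne
  rw [hc] at hp
  obtain ⟨h1, h2, h3⟩ := hp.steps
  have hca := hq.snd_eq_one hq' hk h0 hs1 hs2 hm hmr hb1 hb2 hlt h1 h2 h3
  obtain rfl : c = a := Cell.ext_iff'.2 ⟨by rw [hca.1, ha1], by rw [hca.2, ha2]⟩
  simp only [TieBreaking.tree, Finset.mem_filter_univ]
  exact ⟨b, hreach, mem_walkEdges.2 ⟨l, [], hc⟩⟩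

theorem IsFan.notMem_tree (hq : IsFan N L r q) (hq' : IsFan N L r q')
    {k : ℕ} (hk : k < N) (h0 : q k 0 = q' k 0) {s a b : Cell L r} (hs1 : s.1.1 = q k 0)
    (hs2 : s.1.2 = 0) {m : ℕ} (hm : 1 ≤ m) (hmr : (m : ℤ) ≤ r)
    (ha2 : a.1.2 = 1) (hb1 : b.1.1 = L + m) (hb2 : b.1.2 = 0) (hlt : q k m < q' k m)
    (T : (fan N L r q q').TieBreaking) : (a, b) ∉ T.tree s := by
  simp only [TieBreaking.tree, Finset.mem_filter_univ]
  rintro ⟨w, hw, hmem⟩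
  obtain ⟨l, l', hl⟩ := mem_walkEdges.1 hmem
  have hsp := T.isShortestPath s w hw
  have hinf : l ++ [a, b] <:+: T.path s w := ⟨[], l', by simp [hl]⟩
  have hhead : (l ++ [a, b]).head? = some s := by
    have := hsp.1.2.1
    rw [hl] at this
    simpa [List.head?_append] using this
  have hwalk := hsp.1.of_infix hinf hhead (y := b) (by simp)
  have hpath := T.consistent s w hw s b _ hinf hhead (by simp)
  have hp := T.isShortestPath s b ⟨_, hwalk⟩
  rw [hpath] at hp
  obtain ⟨h1, h2, h3⟩ := hp.steps
  have := hq.snd_eq_neg_one hq' hk h0 hs1 hs2 hm hmr hb1 hb2 hlt h1 h2 h3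
  omega

/-- Ribs whose gaps decrease by two from row to row, displaced by one where `d` holds. -/
def rib (r : ℤ) (d : ℕ → ℤ → Prop) [∀ k j, Decidable (d k j)] (k : ℕ) (j : ℤ) : ℤ :=
  2 * k * (r + 1 - j) + if j ≠ 0 ∧ d k j then 1 else 0

theorem isFan_rib (N : ℕ) (r : ℤ) (d : ℕ → ℤ → Prop) [∀ k j, Decidable (d k j)] :
    IsFan N (2 * N * (r + 1) + 1) r (rib r d) := by
  have bit : ∀ k j, ∃ e, rib r d k j = 2 * k * (r + 1 - j) + e ∧ 0 ≤ e ∧ e ≤ 1 := by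
    intro k j
    exact ⟨_, rfl, by split_ifs <;> omega⟩
  constructor
  · intro k hk j h0 hr
    obtain ⟨e, he, e0, e1⟩ := bit k j
    rw [he]
    have : 0 ≤ 2 * (k : ℤ) * (r + 1 - j) := mul_nonneg (by positivity) (by omega)
    omega
  · intro k hk j h0 hr
    obtain ⟨e, he, e0, e1⟩ := bit k j
    rw [he]
    have : 2 * (k : ℤ) * (r + 1 - j) ≤ 2 * N * (r + 1) :=
      mul_le_mul (by omega) (by omega) (by omega) (by positivity)
    omega
  · intro k l hkl hl j h0 hr
    obtain ⟨e, he, e0, e1⟩ := bit k j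
    obtain ⟨f, hf, f0, f1⟩ := bit l j
    rw [he, hf]
    have : (1 : ℤ) * 1 ≤ ((l : ℤ) - k) * (r + 1 - j) :=
      mul_le_mul (by omega) (by omega) (by omega) (by omega)
    linarith
  · intro k l hkl hl j h0 hr
    obtain ⟨e, he, e0, e1⟩ := bit k j
    obtain ⟨f, hf, f0, f1⟩ := bit l j
    obtain ⟨e', he', e0', e1'⟩ := bit k (j + 1)
    obtain ⟨f', hf', f0', f1'⟩ := bit l (j + 1)
    rw [he, hf, he', hf']
    have : (1 : ℤ) ≤ l - k := by omega
    linarith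

end Fan

theorem exists_planar_shatters (r : ℕ) :
    ∃ (V : Type) (_ : Fintype V) (_ : DecidableEq V) (G : Digraph V) (X : Finset (V × V)),
      G.IsPlanar ∧ (∀ e ∈ X, G.Adj e.1 e.2) ∧ X.card = r ∧
        Nonempty G.TieBreaking ∧
        ∀ T : G.TieBreaking, T.shortestPathTrees.Shatters X := by
  let N := 2 ^ r
  let L : ℤ := 2 * N * ((r : ℤ) + 1) + 1
  let q := rib r fun k j => k.testBit (j.toNat - 1) = true
  let q' := rib r fun k j => ¬ k.testBit (j.toNat - 1) = true
  have hq : IsFan N L r q := isFan_rib ..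
  have hq' : IsFan N L r q' := isFan_rib ..
  have h0 : ∀ k, q k 0 = q' k 0 := fun k => by simp [q, q', rib]
  have hL : 0 ≤ L := by positivity
  let a (i : Fin r) : Cell L r := .mk (L + (i + 1 : ℕ)) 1 (by have := i.2; push_cast; omega)
  let b (i : Fin r) : Cell L r := .mk (L + (i + 1 : ℕ)) 0 (by have := i.2; push_cast; omega)
  let e (i : Fin r) : Cell L r × Cell L r := (a i, b i)
  have he : Function.Injective e := by
    intro i j h
    have := congrArg (fun x => x.1.1.1) h
    simp only [e, a, Cell.mk] at this
    omega
  refine ⟨Cell L r, inferInstance, inferInstance, fan N L r q q', Finset.univ.map ⟨e, he⟩,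
    fan_isPlanar hq hq', ?_, by simp, Digraph.nonempty_tieBreaking _, fun T t ht => ?_⟩
  · intro x hx
    obtain ⟨i, -, rfl⟩ := Finset.mem_map.1 hx
    refine .inl (.inr (.inr ?_))
    simp [e, a, b, Cell.mk]
  · let k := Nat.ofBits fun i => decide (e i ∈ t)
    have hk : k < N := Nat.ofBits_lt_two_pow _
    have hk0 := hq.nonneg k hk 0 le_rfl (by omega)
    have hkL := hq.le k hk 0 le_rfl (by omega)
    let s : Cell L r := .mk (q k 0) 0 (by omega)
    have main : ∀ i, e i ∈ T.tree s ↔ e i ∈ t := by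
      intro i
      have hbit : k.testBit i = decide (e i ∈ t) := Nat.testBit_ofBits_lt _ _ i.2
      have hne : ((i : ℕ) : ℤ) + 1 ≠ 0 := by omega
      constructor
      · intro h
        by_contra hi
        refine hq.notMem_tree hq' hk (h0 k) (s := s) (m := i + 1) rfl rfl (by omega)
          (by have := i.2; omega) rfl rfl rfl ?_ T h
        simp only [q, q', rib, Int.toNat_natCast, Nat.add_sub_cancel, hbit, hi]
        simp [hne]
      · intro hi
        refine hq.mem_tree hq' hk (h0 k) (s := s) (m := i + 1) rfl rfl (by omega)
          (by have := i.2; omega) rfl rfl rfl rfl ?_ T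
        simp only [q, q', rib, Int.toNat_natCast, Nat.add_sub_cancel, hbit, hi]
        simp [hne]
    refine ⟨T.tree s, Finset.mem_image_of_mem _ (Finset.mem_univ s), ?_⟩
    ext x
    rw [Finset.mem_inter]
    constructor
    · rintro ⟨hx, hx'⟩
      obtain ⟨i, -, rfl⟩ := Finset.mem_map.1 hx
      exact (main i).1 hx'
    · intro hx
      refine ⟨ht hx, ?_⟩
      obtain ⟨i, -, rfl⟩ := Finset.mem_map.1 (ht hx)
      exact (main i).2 hx

theorem mainTheorem4 :
    (∀ r : ℕ, 1 ≤ r →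
      ∃ (V : Type) (_ : Fintype V) (_ : DecidableEq V) (G : Digraph V) (X : Finset (V × V)),
        G.IsPlanar ∧ (∀ e ∈ X, G.Adj e.1 e.2) ∧ X.card = r ∧
          Nonempty G.TieBreaking ∧
          ∀ T : G.TieBreaking, T.shortestPathTrees.Shatters X) ∧
    (∀ d : ℕ,
      ∃ (V : Type) (_ : Fintype V) (_ : DecidableEq V) (G : Digraph V),
        G.IsPlanar ∧ Nonempty G.TieBreaking ∧
          ∀ T : G.TieBreaking, d < T.shortestPathTrees.vcDim) := by
  refine ⟨fun r _ => exists_planar_shatters r, fun d => ?_⟩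
  obtain ⟨V, i₁, i₂, G, X, hG, -, hX, hT, h⟩ := exists_planar_shatters (d + 1)
  refine ⟨V, i₁, i₂, G, hG, hT, fun T => ?_⟩
  have := (h T).card_le_vcDim
  omega
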